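/- Let $\mathbb{Q}\langle a,b\rangle$ be the algebra of polynomials in noncommuting variables $a,b$, and put $c=a+b$, $d=ab+ba$. Let $\Delta$ be the linear map with $\Delta(u_1\cdots u_n)=\sum_{i=1}^n u_1\cdots u_{i-1}\otimes u_{i+1}\cdots u_n$ on $ab$-words, and write $\Delta(u)=\sum_u u_{(1)}\otimes u_{(2)}$. The mixing operator $M$ is the bilinear operator on $\mathbb{Q}\langle a,b\rangle$ given on $ab$-words $u,v$ by $$M(u,v)=\sum_{r=1}^2\sum_{s=1}^2\ \sum_{n\ge 2,\ n-r-s-1\text{ even}} M_{r,s,n}(u,v),$$ where the bilinear operators $M_{r,s,n}$ are defined by $M_{1,2,2}(u,v)=u\,a\,v$, $M_{2,1,2}(u,v)=v\,b\,u$, $M_{1,1,2}=M_{2,2,2}=0$ and, for $n\ge 2$, $$M_{1,s,n+1}(u,v)=\sum_u u_{(1)}\,a\,M_{2,s,n}(u_{(2)},v),\qquad M_{2,s,n+1}(u,v)=\sum_v v_{(1)}\,b\,M_{1,s,n}(u,v_{(2)}).$$ (For given words only finitely many terms are nonzero.) A Delannoy path is a lattice path in $\mathbb{Z}^2$ consisting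 of East steps $(1,0)$, North steps $(0,1)$ and Northeast steps $(1,1)$. Give each East step and each North step the weight $c$ and each Northeast step the weight $2d-c^2$; the weight of a path is the product of the weights of its steps, multiplied left to right in the order in which the path traverses them. **Theorem.** For all integers $i,j\ge 0$, $M(c^i,c^j)$ equals one half of the total weight of all Delannoy paths from $(-1,0)$ or $(0,-1)$ to $(i,j)$. -/

import Mathlib

open scoped TensorProduct

/-- The two letters `a` and `b`. -/
inductive ABLetter
  | a
  | b

/-- The noncommutative polynomial algebra `ℚ⟨a, b⟩`. -/
abbrev ABAlg : Type := FreeAlgebra ℚ ABLetter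

namespace ABAlg

noncomputable section

/-- The variable `a`. -/
def a : ABAlg := FreeAlgebra.ι ℚ ABLetter.a

/-- The variable `b`. -/
def b : ABAlg := FreeAlgebra.ι ℚ ABLetter.b

/-- `c = a + b`. -/
def c : ABAlg := a + b

/-- `d = ab + ba`. -/
def d : ABAlg := a * b + b * a

/-- The monomial `u₁ u₂ ⋯ uₙ` of an `ab`-word; the empty word gives `1`. -/
def word (u : List ABLetter) : ABAlg := (u.map (FreeAlgebra.ι ℚ)).prod

/-- The basis of `ℚ⟨a, b⟩` consisting of all `ab`-words. -/
def wordBasis : Module.Basis (List ABLetter) ℚ ABAlg :=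
  (FreeAlgebra.basisFreeMonoid ℚ ABLetter).reindex FreeMonoid.toList

theorem wordBasis_apply (u : List ABLetter) : wordBasis u = word u := by
  have h : wordBasis u = FreeAlgebra.equivMonoidAlgebraFreeMonoid.symm
      (MonoidAlgebra.single (FreeMonoid.ofList u) (1 : ℚ)) := by
    simp [wordBasis, FreeAlgebra.basisFreeMonoid]
  rw [h, AlgEquiv.symm_apply_eq, word, map_list_prod, List.map_map]
  clear h
  induction u with
  | nil => rfl
  | cons x u ih =>
    rw [List.map_cons, List.prod_cons, ← ih, FreeMonoid.ofList_cons]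
    simp [FreeAlgebra.equivMonoidAlgebraFreeMonoid, MonoidAlgebra.single_mul_single]

/-- The coproduct `Δ`, the linear map with
`Δ(u₁ ⋯ uₙ) = ∑ᵢ u₁ ⋯ uᵢ₋₁ ⊗ uᵢ₊₁ ⋯ uₙ` on `ab`-words. -/
def coprod : ABAlg →ₗ[ℚ] ABAlg ⊗[ℚ] ABAlg :=
  wordBasis.constr ℚ fun u =>
    ∑ i ∈ Finset.range u.length, word (u.take i) ⊗ₜ[ℚ] word (u.drop (i + 1))

theorem coprod_word (u : List ABLetter) :
    coprod (word u) =
      ∑ i ∈ Finset.range u.length, word (u.take i) ⊗ₜ[ℚ] word (u.drop (i + 1)) := by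
  rw [← wordBasis_apply, coprod, Module.Basis.constr_basis]

/-- In Sweedler notation `Δ(w) = ∑ w₍₁₎ ⊗ w₍₂₎`, for `x ∈ ℚ⟨a, b⟩` and a linear map `g`,
this is `sweedler x g w = ∑ w₍₁₎ * x * g(w₍₂₎)`; it is linear in `w` and in `g`. -/
def sweedler (x : ABAlg) : (ABAlg →ₗ[ℚ] ABAlg) →ₗ[ℚ] ABAlg →ₗ[ℚ] ABAlg where
  toFun g := LinearMap.mul' ℚ ABAlg ∘ₗ TensorProduct.map (LinearMap.mulRight ℚ x) g ∘ₗ coprod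
  map_add' g h := by rw [TensorProduct.map_add_right, LinearMap.add_comp, LinearMap.comp_add]
  map_smul' t g := by
    rw [TensorProduct.map_smul_right, LinearMap.smul_comp, LinearMap.comp_smul, RingHom.id_apply]

theorem sweedler_word (x : ABAlg) (g : ABAlg →ₗ[ℚ] ABAlg) (w : List ABLetter) :
    sweedler x g (word w) =
      ∑ i ∈ Finset.range w.length, word (w.take i) * x * g (word (w.drop (i + 1))) := by
  simp [sweedler, coprod_word]

/-- The bilinear operators `M_{r,s,n}`; `mixR r s n u v` is `M_{r,s,n}(u, v)`. They are given by
* `M_{1,2,2}(u, v) = u a v` and `M_{2,1,2}(u, v) = v b u`,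
* `M_{1,s,n+1}(u, v) = ∑ u₍₁₎ a M_{2,s,n}(u₍₂₎, v)` for `n ≥ 2`,
* `M_{2,s,n+1}(u, v) = ∑ v₍₁₎ b M_{1,s,n}(u, v₍₂₎)` for `n ≥ 2`,
and are zero for all other indices. -/
def mixR : ℕ → ℕ → ℕ → (ABAlg →ₗ[ℚ] ABAlg →ₗ[ℚ] ABAlg)
  | 1, 2, 2 => LinearMap.mul ℚ ABAlg ∘ₗ LinearMap.mulRight ℚ a
  | 2, 1, 2 => (LinearMap.mul ℚ ABAlg ∘ₗ LinearMap.mulRight ℚ b).flip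
  | 1, s, n + 3 => (sweedler a ∘ₗ (mixR 2 s (n + 2)).flip).flip
  | 2, s, n + 3 => sweedler b ∘ₗ mixR 1 s (n + 2)
  | _, _, _ => 0

theorem mixR_one_two_two (u v : ABAlg) : mixR 1 2 2 u v = u * a * v := by
  simp [mixR]

theorem mixR_two_one_two (u v : ABAlg) : mixR 2 1 2 u v = v * b * u := by
  simp [mixR]

theorem mixR_one_one_two (u v : ABAlg) : mixR 1 1 2 u v = 0 := by
  simp [mixR]

theorem mixR_two_two_two (u v : ABAlg) : mixR 2 2 2 u v = 0 := by
  simp [mixR]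

theorem mixR_one_succ (s n : ℕ) (hn : 2 ≤ n) (u v : ABAlg) :
    mixR 1 s (n + 1) u v = sweedler a ((mixR 2 s n).flip v) u := by
  obtain ⟨n, rfl⟩ := Nat.exists_eq_add_of_le' hn
  simp [mixR]

theorem mixR_two_succ (s n : ℕ) (hn : 2 ≤ n) (u v : ABAlg) :
    mixR 2 s (n + 1) u v = sweedler b (mixR 1 s n u) v := by
  obtain ⟨n, rfl⟩ := Nat.exists_eq_add_of_le' hn
  simp [mixR]

/-- The defining recursion on `ab`-words. -/
theorem mixR_one_succ_word (s n : ℕ) (hn : 2 ≤ n) (u v : List ABLetter) :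
    mixR 1 s (n + 1) (word u) (word v) =
      ∑ i ∈ Finset.range u.length,
        word (u.take i) * a * mixR 2 s n (word (u.drop (i + 1))) (word v) := by
  simp [mixR_one_succ s n hn, sweedler_word]

/-- The defining recursion on `ab`-words. -/
theorem mixR_two_succ_word (s n : ℕ) (hn : 2 ≤ n) (u v : List ABLetter) :
    mixR 2 s (n + 1) (word u) (word v) =
      ∑ i ∈ Finset.range v.length,
        word (v.take i) * b * mixR 1 s n (word u) (word (v.drop (i + 1))) := by
  simp [mixR_two_succ s n hn, sweedler_word]

/-- For fixed `ab`-words `u` and `v`, only `n ≤ |u| + |v| + 2` can contribute to `M(u, v)`. -/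
theorem mixR_word_eq_zero (s n : ℕ) : ∀ (u v : List ABLetter), u.length + v.length + 2 < n →
    mixR 1 s n (word u) (word v) = 0 ∧ mixR 2 s n (word u) (word v) = 0 := by
  induction n with
  | zero => intro u v h; omega
  | succ n ih =>
    intro u v h
    rw [mixR_one_succ_word s n (by omega), mixR_two_succ_word s n (by omega)]
    constructor
    · refine Finset.sum_eq_zero fun i hi => ?_
      rw [Finset.mem_range] at hi
      rw [(ih _ _ (by rw [List.length_drop]; omega)).2, mul_zero]
    · refine Finset.sum_eq_zero fun i hi => ?_
      rw [Finset.mem_range] at hi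
      rw [(ih _ _ (by rw [List.length_drop]; omega)).1, mul_zero]

/-- The value `M(u, v) = ∑_{r=1}^2 ∑_{s=1}^2 ∑_n M_{r,s,n}(u, v)` of the mixing operator on
`ab`-words, `n` running over the integers `n ≥ 2` with `n - r - s - 1` even. The bound on `n` only
drops zero terms, by `mixR_word_eq_zero`. -/
def mixWord (u v : List ABLetter) : ABAlg :=
  ∑ r ∈ Finset.Icc (1 : ℕ) 2, ∑ s ∈ Finset.Icc (1 : ℕ) 2,
    ∑ n ∈ (Finset.Icc 2 (u.length + v.length + 2)).filter
        (fun n : ℕ => Even ((n : ℤ) - r - s - 1)),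
      mixR r s n (word u) (word v)

/-- The mixing operator `M`, the bilinear extension of `mixWord` from `ab`-words to `ℚ⟨a, b⟩`. -/
def mixing : ABAlg →ₗ[ℚ] ABAlg →ₗ[ℚ] ABAlg :=
  wordBasis.constr ℚ fun u => wordBasis.constr ℚ fun v => mixWord u v

theorem mixing_word (u v : List ABLetter) : mixing (word u) (word v) = mixWord u v := by
  rw [← wordBasis_apply, ← wordBasis_apply, mixing, Module.Basis.constr_basis,
    Module.Basis.constr_basis]

end

end ABAlg

/-- The steps of a Delannoy path. -/
inductive DelannoyStep
  | east
  | north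
  | northeast

namespace DelannoyStep

/-- The displacement of a step. -/
def vec : DelannoyStep → ℤ × ℤ
  | east => (1, 0)
  | north => (0, 1)
  | northeast => (1, 1)

/-- The weight of a step: `c` for East and North, `2d - c²` for Northeast. -/
noncomputable def weight : DelannoyStep → ABAlg
  | east => ABAlg.c
  | north => ABAlg.c
  | northeast => 2 * ABAlg.d - ABAlg.c ^ 2

end DelannoyStep

/-- The Delannoy paths from `p` to `q`, each given by its list of steps in path order. -/
def delannoyPaths (p q : ℤ × ℤ) : Set (List DelannoyStep) :=
  {l | p + (l.map DelannoyStep.vec).sum = q}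

/-- The weight of a path is the product of the weights of its steps, in path order. -/
noncomputable def delannoyWeight (l : List DelannoyStep) : ABAlg :=
  (l.map DelannoyStep.weight).prod

theorem DelannoyStep.length_le_sum (l : List DelannoyStep) :
    (l.length : ℤ) ≤ (l.map DelannoyStep.vec).sum.1 + (l.map DelannoyStep.vec).sum.2 := by
  induction l with
  | nil => simp
  | cons x l ih =>
    rw [List.map_cons, List.sum_cons, List.length_cons, Prod.fst_add, Prod.snd_add]
    cases x <;> simp only [DelannoyStep.vec] <;> push_cast <;> omega

instance : Finite DelannoyStep :=
  Finite.of_surjective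
    (fun k : Fin 3 => if k = 0 then .east else if k = 1 then .north else .northeast) fun x => by
      cases x
      · exact ⟨0, rfl⟩
      · exact ⟨1, rfl⟩
      · exact ⟨2, rfl⟩

/-- There are finitely many Delannoy paths between two given points. -/
theorem finite_delannoyPaths (p q : ℤ × ℤ) : (delannoyPaths p q).Finite := by
  refine (List.finite_length_le DelannoyStep (q.1 - p.1 + (q.2 - p.2)).toNat).subset ?_
  intro l hl
  have h := DelannoyStep.length_le_sum l
  have h1 : p + (l.map DelannoyStep.vec).sum = q := hl
  have h2 := congrArg Prod.fst h1
  have h3 := congrArg Prod.snd h1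
  rw [Prod.fst_add] at h2
  rw [Prod.snd_add] at h3
  simp only [Set.mem_ofPred_eq]
  omega

/-- The total weight of all Delannoy paths from `p` to `q` (a finite sum by
`finite_delannoyPaths`). -/
noncomputable def delannoyTotalWeight (p q : ℤ × ℤ) : ABAlg :=
  ∑ᶠ l ∈ delannoyPaths p q, delannoyWeight l

-- Deconcatenation and powers of `c`

namespace ABAlg

noncomputable section

-- Write L and R for the `r = 1` and `r = 2` parts of M(c^i, c^j). Deleting the first letter of c·w
-- gives w for either letter, so the coproduct recursion collapses (`mixTrunc_c_pow`) to L(i+1,j) =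
-- c L(i,j) + 2a R(i,j) and R(i,j+1) = c R(i,j) + 2b L(i,j). Eliminating L and R separately, S = L +
-- R satisfies the Delannoy recursion with diagonal weight -(a-b)^2 = 2d - c^2 (`mixPow_succ_succ`).
-- Path weights from the origin satisfy the same recursion by their first step. By translation, the
-- claim is 2 S(i,j) = D(i+1,j) + D(i,j+1), with D the total weight from the origin; both sides
-- agree on the axes (`two_mul_mixPow`).

theorem word_cons (x : ABLetter) (u : List ABLetter) :
    word (x :: u) = FreeAlgebra.ι ℚ x * word u := by
  simp [word]

/-- The deleted letter is either the leading one or lies in `w`. -/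
theorem sweedler_letter_mul (x : ABAlg) (g : ABAlg →ₗ[ℚ] ABAlg) (l : ABLetter) (w : ABAlg) :
    sweedler x g (FreeAlgebra.ι ℚ l * w) = x * g w + FreeAlgebra.ι ℚ l * sweedler x g w := by
  have h : sweedler x g ∘ₗ LinearMap.mulLeft ℚ (FreeAlgebra.ι ℚ l) =
      LinearMap.mulLeft ℚ x ∘ₗ g + LinearMap.mulLeft ℚ (FreeAlgebra.ι ℚ l) ∘ₗ sweedler x g := by
    refine wordBasis.ext fun u => ?_
    simp only [wordBasis_apply, LinearMap.comp_apply, LinearMap.add_apply,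
      LinearMap.mulLeft_apply]
    rw [← word_cons, sweedler_word, sweedler_word, List.length_cons, Finset.sum_range_succ',
      Finset.mul_sum, add_comm]
    congr 1
    · simp [word]
    · exact Finset.sum_congr rfl fun i _ => by simp [word_cons, mul_assoc]
  exact LinearMap.congr_fun h w

theorem sweedler_one (x : ABAlg) (g : ABAlg →ₗ[ℚ] ABAlg) : sweedler x g 1 = 0 := by
  simpa [word] using sweedler_word x g []

theorem sweedler_c_mul (x : ABAlg) (g : ABAlg →ₗ[ℚ] ABAlg) (w : ABAlg) :
    sweedler x g (c * w) = 2 * (x * g w) + c * sweedler x g w := by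
  rw [c, add_mul, map_add, a, b, sweedler_letter_mul, sweedler_letter_mul, add_mul, two_mul]
  abel

/-- Linear maps that agree on the words of length `i` agree on `c ^ i`. -/
theorem map_c_pow_congr (i : ℕ) : ∀ f g : ABAlg →ₗ[ℚ] ABAlg,
    (∀ u : List ABLetter, u.length = i → f (word u) = g (word u)) → f (c ^ i) = g (c ^ i) := by
  induction i with
  | zero => intro f g h; simpa [word] using h [] rfl
  | succ i ih =>
    intro f g h
    have key (l : ABLetter) :
        f (FreeAlgebra.ι ℚ l * c ^ i) = g (FreeAlgebra.ι ℚ l * c ^ i) :=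
      ih (f ∘ₗ LinearMap.mulLeft ℚ (FreeAlgebra.ι ℚ l))
        (g ∘ₗ LinearMap.mulLeft ℚ (FreeAlgebra.ι ℚ l)) fun u hu => by
          simpa [word_cons] using h (l :: u) (by simp [hu])
    have ha := key .a
    have hb := key .b
    rw [pow_succ', c, add_mul, map_add, map_add]
    exact congrArg₂ (· + ·) ha hb

-- Parity and truncation of the mixing operator

/-- Each recursion step raises the length by one and swaps `r`, preserving the parity of length + r
+ s, which is odd for both nonzero initial operators. Hence the parity condition in M drops only
zero terms. -/
theorem mixR_eq_zero_of_odd (n : ℕ) : ∀ s ∈ Finset.Icc 1 2,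
    (Odd (n + s) → mixR 1 s (n + 2) = 0) ∧ (Even (n + s) → mixR 2 s (n + 2) = 0) := by
  induction n with
  | zero =>
    intro s hs
    obtain ⟨h1, h2⟩ := Finset.mem_Icc.1 hs
    interval_cases s <;> refine ⟨fun h => ?_, fun h => ?_⟩ <;>
      first
      | exact absurd h (by decide)
      | simp [mixR]
  | succ n ih =>
    intro s hs
    refine ⟨fun h => ?_, fun h => ?_⟩
    · have h2 := (ih s hs).2 (by rcases h with ⟨k, hk⟩; exact ⟨k, by omega⟩)
      refine LinearMap.ext₂ fun u v => ?_
      rw [mixR_one_succ s (n + 2) (by omega), h2]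
      exact LinearMap.congr_fun (map_zero (sweedler a)) u
    · have h2 := (ih s hs).1 (by rcases h with ⟨k, hk⟩; exact ⟨k - 1, by omega⟩)
      refine LinearMap.ext₂ fun u v => ?_
      rw [mixR_two_succ s (n + 2) (by omega), h2]
      simp

/-- The sum of the `M_{r,s,n}` over `s ∈ {1, 2}` and `2 ≤ n < N + 2`. -/
def mixTrunc (r N : ℕ) : ABAlg →ₗ[ℚ] ABAlg →ₗ[ℚ] ABAlg :=
  ∑ n ∈ Finset.range N, (mixR r 1 (n + 2) + mixR r 2 (n + 2))

theorem mixTrunc_one_succ (N : ℕ) (u v : ABAlg) :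
    mixTrunc 1 (N + 1) u v = u * a * v + sweedler a ((mixTrunc 2 N).flip v) u := by
  have h : (mixTrunc 2 N).flip v =
      ∑ n ∈ Finset.range N, ((mixR 2 1 (n + 2)).flip v + (mixR 2 2 (n + 2)).flip v) := by
    ext w
    simp [mixTrunc]
  rw [h, mixTrunc, Finset.sum_range_succ', add_comm]
  simp only [LinearMap.add_apply, LinearMap.sum_apply, map_sum, map_add, zero_add,
    mixR_one_one_two, mixR_one_two_two]
  exact congrArg _ (Finset.sum_congr rfl fun n _ => by
    rw [mixR_one_succ 1 (n + 2) (by omega), mixR_one_succ 2 (n + 2) (by omega)])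

theorem mixTrunc_two_succ (N : ℕ) (u v : ABAlg) :
    mixTrunc 2 (N + 1) u v = v * b * u + sweedler b (mixTrunc 1 N u) v := by
  rw [mixTrunc, mixTrunc, Finset.sum_range_succ', add_comm]
  simp only [LinearMap.add_apply, LinearMap.sum_apply, map_sum, map_add, zero_add, add_zero,
    mixR_two_one_two, mixR_two_two_two]
  exact congrArg _ (Finset.sum_congr rfl fun n _ => by
    rw [mixR_two_succ 1 (n + 2) (by omega), mixR_two_succ 2 (n + 2) (by omega)])

theorem mixR_sum_filter (r s : ℕ) (hr : r ∈ Finset.Icc 1 2) (hs : s ∈ Finset.Icc 1 2)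
    (u v : List ABLetter) (N : ℕ) (hN : u.length + v.length < N) :
    ∑ n ∈ (Finset.Icc 2 (u.length + v.length + 2)).filter
        (fun n : ℕ => Even ((n : ℤ) - r - s - 1)), mixR r s n (word u) (word v) =
      ∑ n ∈ Finset.range N, mixR r s (n + 2) (word u) (word v) := by
  have hr' : r = 1 ∨ r = 2 := by
    have := Finset.mem_Icc.1 hr
    omega
  rw [Finset.sum_filter_of_ne, Finset.sum_subset (s₂ := Finset.Ico 2 (N + 2)),
    Finset.sum_Ico_eq_sum_range, Nat.add_sub_cancel]
  · exact Finset.sum_congr rfl fun n _ => by rw [add_comm]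
  · intro n hn
    simp only [Finset.mem_Icc, Finset.mem_Ico] at hn ⊢
    omega
  · intro n hn hn'
    simp only [Finset.mem_Icc, Finset.mem_Ico] at hn hn'
    have := mixR_word_eq_zero s n u v (by omega)
    rcases hr' with rfl | rfl
    · exact this.1
    · exact this.2
  · intro n hn hne
    obtain ⟨m, rfl⟩ := Nat.exists_eq_add_of_le' (Finset.mem_Icc.1 hn).1
    have key := mixR_eq_zero_of_odd m s hs
    by_contra hodd
    rw [Int.not_even_iff_odd] at hodd
    obtain ⟨k, hk⟩ := hodd
    refine hne ?_
    rcases hr' with rfl | rfl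
    · rw [key.1 ⟨(k + s).toNat, by push_cast at hk; omega⟩]
      rfl
    · rw [key.2 ⟨(k + s + 1).toNat, by push_cast at hk; omega⟩]
      rfl

theorem mixWord_eq_mixTrunc (u v : List ABLetter) (N : ℕ) (hN : u.length + v.length < N) :
    mixWord u v = mixTrunc 1 N (word u) (word v) + mixTrunc 2 N (word u) (word v) := by
  have h : Finset.Icc 1 2 = ({1, 2} : Finset ℕ) := rfl
  rw [mixWord, Finset.sum_congr rfl fun r hr => Finset.sum_congr rfl fun s hs =>
    mixR_sum_filter r s hr hs u v N hN]
  simp [h, mixTrunc, Finset.sum_add_distrib, LinearMap.sum_apply, add_add_add_comm]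

theorem mixing_c_pow_eq_mixTrunc (i j : ℕ) :
    mixing (c ^ i) (c ^ j) =
      mixTrunc 1 (i + j + 1) (c ^ i) (c ^ j) + mixTrunc 2 (i + j + 1) (c ^ i) (c ^ j) := by
  -- c^i and c^j involve only words of lengths i and j, so one truncation bound serves all pairs.
  refine map_c_pow_congr j (mixing (c ^ i))
    (mixTrunc 1 (i + j + 1) (c ^ i) + mixTrunc 2 (i + j + 1) (c ^ i)) fun v hv => ?_
  refine map_c_pow_congr i (mixing.flip (word v)) ((mixTrunc 1 (i + j + 1)).flip (word v) +
    (mixTrunc 2 (i + j + 1)).flip (word v)) fun u hu => ?_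
  simpa [mixing_word] using mixWord_eq_mixTrunc u v (i + j + 1) (by omega)

-- Recursions for powers of `c`

mutual

/-- The part of `M(c ^ i, c ^ j)` whose terms start with a factor of `c ^ i`. -/
def mixPowLeft : ℕ → ℕ → ABAlg
  | 0, j => a * c ^ j
  | i + 1, j => c * mixPowLeft i j + 2 * (a * mixPowRight i j)
termination_by i j => i + j

/-- The part of `M(c ^ i, c ^ j)` whose terms start with a factor of `c ^ j`. -/
def mixPowRight : ℕ → ℕ → ABAlg
  | i, 0 => b * c ^ i
  | i, j + 1 => c * mixPowRight i j + 2 * (b * mixPowLeft i j)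
termination_by i j => i + j

end

theorem mixTrunc_c_pow (N : ℕ) : ∀ i j : ℕ, i + j < N →
    mixTrunc 1 N (c ^ i) (c ^ j) = mixPowLeft i j ∧
      mixTrunc 2 N (c ^ i) (c ^ j) = mixPowRight i j := by
  induction N with
  | zero => intro i j h; omega
  | succ N ih =>
    intro i j h
    constructor
    -- The c-term keeps the truncation level and needs this inner induction; the crossing term
    -- lowers it and uses `ih`.
    · induction i with
      | zero => simp [mixTrunc_one_succ, sweedler_one, mixPowLeft]
      | succ i hi =>
        rw [mixPowLeft, ← hi (by omega), ← (ih i j (by omega)).2, mixTrunc_one_succ,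
          mixTrunc_one_succ, pow_succ', sweedler_c_mul, LinearMap.flip_apply]
        noncomm_ring
    · induction j with
      | zero => simp [mixTrunc_two_succ, sweedler_one, mixPowRight]
      | succ j hj =>
        rw [mixPowRight, ← hj (by omega), ← (ih i j (by omega)).1, mixTrunc_two_succ,
          mixTrunc_two_succ, pow_succ', sweedler_c_mul]
        noncomm_ring

theorem mixing_c_pow (i j : ℕ) :
    mixing (c ^ i) (c ^ j) = mixPowLeft i j + mixPowRight i j := by
  have h := mixTrunc_c_pow (i + j + 1) i j (by omega)
  rw [mixing_c_pow_eq_mixTrunc, h.1, h.2]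

theorem mixPow_succ_zero (i : ℕ) :
    mixPowLeft (i + 1) 0 + mixPowRight (i + 1) 0 =
      c * (mixPowLeft i 0 + mixPowRight i 0) + d * c ^ i := by
  rw [mixPowLeft, mixPowRight, mixPowRight, pow_succ']
  generalize c ^ i = x
  generalize mixPowLeft i 0 = y
  rw [c, d]
  noncomm_ring

theorem mixPow_zero_succ (j : ℕ) :
    mixPowLeft 0 (j + 1) + mixPowRight 0 (j + 1) =
      c * (mixPowLeft 0 j + mixPowRight 0 j) + d * c ^ j := by
  rw [mixPowRight, mixPowLeft, mixPowLeft, pow_succ']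
  generalize c ^ j = x
  generalize mixPowRight 0 j = y
  rw [c, d]
  noncomm_ring

/-- Since 2a - c = a - b = -(2b - c), the defect S(i+1,j+1) - c S(i,j+1) - c S(i+1,j) is
(a-b)(R(i,j+1) - L(i+1,j)). One more expansion turns the second factor into -(a-b) S(i,j). -/
theorem mixPow_succ_succ (i j : ℕ) :
    mixPowLeft (i + 1) (j + 1) + mixPowRight (i + 1) (j + 1) =
      c * (mixPowLeft i (j + 1) + mixPowRight i (j + 1)) +
      c * (mixPowLeft (i + 1) j + mixPowRight (i + 1) j) +
      (2 * d - c ^ 2) * (mixPowLeft i j + mixPowRight i j) := by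
  rw [mixPowLeft.eq_2 (j + 1) i, mixPowRight.eq_2 (i + 1) j, mixPowLeft.eq_2 j i,
    mixPowRight.eq_2 i j]
  generalize mixPowLeft i (j + 1) = x
  generalize mixPowRight (i + 1) j = y
  generalize mixPowLeft i j = z
  generalize mixPowRight i j = w
  rw [c, d]
  noncomm_ring

end

end ABAlg

open ABAlg

-- Weights of Delannoy paths

theorem delannoyTotalWeight_eq_zero_sub (p q : ℤ × ℤ) :
    delannoyTotalWeight p q = delannoyTotalWeight 0 (q - p) := by
  have h : delannoyPaths p q = delannoyPaths 0 (q - p) := by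
    ext l
    simp only [delannoyPaths, Set.mem_ofPred_eq, zero_add, eq_sub_iff_add_eq']
  rw [delannoyTotalWeight, h, delannoyTotalWeight]

/-- Decomposition of the paths by their first step. -/
theorem delannoyPaths_zero_eq (q : ℤ × ℤ) (hq : q ≠ 0) :
    delannoyPaths 0 q = ⋃ s : DelannoyStep, List.cons s '' delannoyPaths 0 (q - s.vec) := by
  ext l
  simp only [delannoyPaths, Set.mem_iUnion, Set.mem_image, Set.mem_ofPred_eq, zero_add]
  cases l with
  | nil => simpa using hq.symm
  | cons s l => simp [eq_sub_iff_add_eq']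

theorem delannoyTotalWeight_cons (s : DelannoyStep) (q : ℤ × ℤ) :
    ∑ᶠ l ∈ List.cons s '' delannoyPaths 0 q, delannoyWeight l =
      s.weight * delannoyTotalWeight 0 q := by
  rw [finsum_mem_image (List.cons_injective.injOn), delannoyTotalWeight,
    finsum_mem_eq_finite_toFinset_sum _ (finite_delannoyPaths 0 q),
    finsum_mem_eq_finite_toFinset_sum _ (finite_delannoyPaths 0 q), Finset.mul_sum]
  simp [delannoyWeight]

/-- The first step factors out on the left, as in the recursion for M; `hq` excludes the empty path.
-/
theorem delannoyTotalWeight_zero_step (q : ℤ × ℤ) (hq : q ≠ 0) :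
    delannoyTotalWeight 0 q = c * delannoyTotalWeight 0 (q - (1, 0)) +
      c * delannoyTotalWeight 0 (q - (0, 1)) +
      (2 * d - c ^ 2) * delannoyTotalWeight 0 (q - (1, 1)) := by
  have hfin (s : DelannoyStep) (p : ℤ × ℤ) : (List.cons s '' delannoyPaths 0 p).Finite :=
    (finite_delannoyPaths 0 p).image _
  have hdisj (s t : DelannoyStep) (hst : s ≠ t) (p r : ℤ × ℤ) :
      Disjoint (List.cons s '' delannoyPaths 0 p) (List.cons t '' delannoyPaths 0 r) := by
    rw [Set.disjoint_left]
    rintro _ ⟨l, -, rfl⟩ ⟨l', -, h⟩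
    exact hst (List.cons.inj h).1.symm
  have h : delannoyPaths 0 q =
      (List.cons .east '' delannoyPaths 0 (q - (1, 0)) ∪
        List.cons .north '' delannoyPaths 0 (q - (0, 1))) ∪
        List.cons .northeast '' delannoyPaths 0 (q - (1, 1)) := by
    rw [delannoyPaths_zero_eq q hq]
    ext l
    simp only [Set.mem_iUnion, Set.mem_union]
    constructor
    · rintro ⟨s, hs⟩
      cases s
      · exact .inl (.inl hs)
      · exact .inl (.inr hs)
      · exact .inr hs
    · rintro ((hs | hs) | hs)
      exacts [⟨_, hs⟩, ⟨_, hs⟩, ⟨_, hs⟩]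
  rw [delannoyTotalWeight, h, finsum_mem_union _ ((hfin _ _).union (hfin _ _)) (hfin _ _),
    finsum_mem_union (hdisj _ _ (by simp) _ _) (hfin _ _) (hfin _ _), delannoyTotalWeight_cons,
    delannoyTotalWeight_cons, delannoyTotalWeight_cons]
  · rfl
  · exact Set.disjoint_union_left.2 ⟨hdisj _ _ (by simp) _ _, hdisj _ _ (by simp) _ _⟩

theorem DelannoyStep.sum_nonneg (l : List DelannoyStep) :
    0 ≤ (l.map DelannoyStep.vec).sum.1 ∧ 0 ≤ (l.map DelannoyStep.vec).sum.2 := by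
  induction l with
  | nil => simp
  | cons x l ih =>
    rw [List.map_cons, List.sum_cons, Prod.fst_add, Prod.snd_add]
    cases x <;> simp only [DelannoyStep.vec] <;> omega

theorem delannoyTotalWeight_eq_zero (q : ℤ × ℤ) (hq : q.1 < 0 ∨ q.2 < 0) :
    delannoyTotalWeight 0 q = 0 := by
  have h : delannoyPaths 0 q = ∅ := by
    refine Set.eq_empty_iff_forall_notMem.2 fun l hl => ?_
    have hl' : (l.map DelannoyStep.vec).sum = q := by simpa [delannoyPaths] using hl
    have := DelannoyStep.sum_nonneg l
    rw [hl'] at this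
    omega
  rw [delannoyTotalWeight, h, finsum_mem_empty]

theorem delannoyTotalWeight_zero_zero : delannoyTotalWeight 0 0 = 1 := by
  have h : delannoyPaths 0 0 = {[]} := by
    ext l
    constructor
    · intro hl
      have h1 := DelannoyStep.length_le_sum l
      have hl' : (l.map DelannoyStep.vec).sum = 0 := by simpa [delannoyPaths] using hl
      rw [hl'] at h1
      exact List.length_eq_zero_iff.1 (by simpa using h1)
    · rintro rfl
      simp [delannoyPaths]
  rw [delannoyTotalWeight, h, finsum_mem_singleton]
  rfl

theorem delannoyTotalWeight_nat_zero (m : ℕ) : delannoyTotalWeight 0 ((m : ℤ), 0) = c ^ m := by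
  induction m with
  | zero => exact delannoyTotalWeight_zero_zero.trans (pow_zero c).symm
  | succ m ih =>
    rw [delannoyTotalWeight_zero_step _ (by simp [Prod.ext_iff]; omega),
      delannoyTotalWeight_eq_zero (_ - (0, 1)) (by simp),
      delannoyTotalWeight_eq_zero (_ - (1, 1)) (by simp)]
    simp [ih, pow_succ']

theorem delannoyTotalWeight_zero_nat (n : ℕ) : delannoyTotalWeight 0 (0, (n : ℤ)) = c ^ n := by
  induction n with
  | zero => exact delannoyTotalWeight_zero_zero.trans (pow_zero c).symm
  | succ n ih =>
    rw [delannoyTotalWeight_zero_step _ (by simp [Prod.ext_iff]; omega),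
      delannoyTotalWeight_eq_zero (_ - (1, 0)) (by simp),
      delannoyTotalWeight_eq_zero (_ - (1, 1)) (by simp)]
    simp [ih, pow_succ']

theorem delannoyTotalWeight_succ_succ (m n : ℕ) :
    delannoyTotalWeight 0 (((m + 1 : ℕ) : ℤ), ((n + 1 : ℕ) : ℤ)) =
      c * delannoyTotalWeight 0 ((m : ℤ), ((n + 1 : ℕ) : ℤ)) +
      c * delannoyTotalWeight 0 (((m + 1 : ℕ) : ℤ), (n : ℤ)) +
      (2 * d - c ^ 2) * delannoyTotalWeight 0 ((m : ℤ), (n : ℤ)) := by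
  rw [delannoyTotalWeight_zero_step _ (by simp [Prod.ext_iff]; omega)]
  simp

-- Comparison of the two recursions

theorem two_mul_mixPow (i j : ℕ) :
    2 * (mixPowLeft i j + mixPowRight i j) =
      delannoyTotalWeight 0 (((i + 1 : ℕ) : ℤ), (j : ℤ)) +
        delannoyTotalWeight 0 ((i : ℤ), ((j + 1 : ℕ) : ℤ)) := by
  induction i generalizing j with
  | zero =>
    induction j with
    | zero =>
      rw [Nat.cast_zero, delannoyTotalWeight_nat_zero, delannoyTotalWeight_zero_nat, mixPowLeft,
        mixPowRight]
      simp [c, two_mul]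
    | succ j ih =>
      rw [Nat.cast_zero, delannoyTotalWeight_zero_nat] at ih ⊢
      -- On the axis, `ih` is solved for D(1,j) = 2 S(0,j) - c^(j+1); the -c^2 of the diagonal
      -- weight then cancels c·D(0,j+1), leaving 2d c^j.
      rw [mixPow_zero_succ, delannoyTotalWeight_succ_succ, Nat.cast_zero,
        delannoyTotalWeight_zero_nat, delannoyTotalWeight_zero_nat,
        eq_sub_of_add_eq ih.symm, pow_succ' c (j + 1), pow_succ' c j]
      generalize c ^ j = x
      noncomm_ring
  | succ i ih =>
    induction j with
    | zero =>
      have ih := ih 0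
      rw [Nat.cast_zero, delannoyTotalWeight_nat_zero] at ih ⊢
      rw [mixPow_succ_zero, delannoyTotalWeight_succ_succ, Nat.cast_zero,
        delannoyTotalWeight_nat_zero, delannoyTotalWeight_nat_zero,
        eq_sub_of_add_eq' ih.symm, pow_succ' c (i + 1), pow_succ' c i]
      generalize c ^ i = x
      noncomm_ring
    | succ j ihj =>
      have h1 := ih (j + 1)
      have h2 := ih j
      rw [mixPow_succ_succ, delannoyTotalWeight_succ_succ (i + 1) j,
        delannoyTotalWeight_succ_succ i (j + 1)]
      linear_combination (norm := noncomm_ring) c * h1 + c * ihj + (2 * d - c ^ 2) * h2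

theorem mainTheorem9 (i j : ℕ) :
    ABAlg.mixing (ABAlg.c ^ i) (ABAlg.c ^ j) =
      (1 / 2 : ℚ) • (delannoyTotalWeight (-1, 0) ((i : ℤ), (j : ℤ)) +
        delannoyTotalWeight (0, -1) ((i : ℤ), (j : ℤ))) := by
  have h := two_mul_mixPow i j
  rw [delannoyTotalWeight_eq_zero_sub (-1, 0), delannoyTotalWeight_eq_zero_sub (0, -1)]
  have h1 : ((i : ℤ), (j : ℤ)) - (-1, 0) = (((i + 1 : ℕ) : ℤ), (j : ℤ)) := by simp
  have h2 : ((i : ℤ), (j : ℤ)) - (0, -1) = ((i : ℤ), ((j + 1 : ℕ) : ℤ)) := by simp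
  rw [h1, h2, ← h, mixing_c_pow, two_mul, ← two_smul ℚ (mixPowLeft i j + _), smul_smul]
  norm_num
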